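/- Let $G$ be a locally compact (Hausdorff) group with a fixed left Haar measure, and write $(L_xf)(y)=f(x^{-1}y)$. Let $S^1(G)$ be a Segal algebra in $L^1(G)$, i.e. a dense subspace of $L^1(G)$ which is a left ideal for convolution, is closed under all left translations $L_x$ $(x\in G)$, and carries a complete norm $\|\cdot\|_S$ for which it is a Banach algebra, the inclusion $S^1(G)\hookrightarrow L^1(G)$ is continuous, $\|f*b\|_S\le\|f\|_1\|b\|_S$ for all $f\in L^1(G)$ and $b\in S^1(G)$, and the linear span of $L^1(G)*S^1(G)$ is $\|\cdot\|_S$-dense in $S^1(G)$. Suppose that $S^1(G)$ is pseudo-amenable, i.e. that there is a (not necessarily bounded) net $(m_\gamma)$ in the projective tensor product $S^1(G)\widehat{\otimes}S^1(G)$ such that $a\cdot m_\gamma-m_\gamma\cdot a\to 0$ and $\pi(m_\gamma)a\to a$ in norm for every $a\in S^1(G)$, where $a\cdot(b\otimes c)=(ab)\otimes c$, $(b\otimes c)\cdot a=b\otimes(ca)$ and $\pi(b\otimes c)=bc$. Then $G$ is amenable, i.e. there is a linear functional $M$ on $L^\infty(G)$ with $\|M\|=M(1)=1$ and $M(L_x\varphi)=M(\varphi)$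 for all $x\in G$ and $\varphi\in L^\infty(G)$. -/

import Mathlib

open MeasureTheory Filter Topology
open scoped ENNReal

noncomputable section

/-! ### Projective tensor products and pseudo-amenable Banach algebras -/

section PseudoAmenable

universe u

variable (A : Type u) [NonUnitalNormedRing A] [NormedSpace ℂ A] [IsScalarTower ℂ A A]
  [SMulCommClass ℂ A A]

/-- The Banach space projective tensor product of `A` with itself: the completion of the
algebraic tensor product `A ⊗ A` (indexed by `Fin 2`) in the projective (semi)norm
`‖m‖ = inf {∑ j, ‖b j‖ * ‖c j‖ | m = ∑ j, b j ⊗ c j}`, which is the norm that Mathlib puts on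
`PiTensorProduct`. -/
abbrev ProjTensorSq : Type u :=
  UniformSpace.Completion (PiTensorProduct ℂ (fun _ : Fin 2 => A))

variable {A}

/-- The elementary tensor `b ⊗ c`. -/
def ProjTensorSq.tmul (b c : A) : ProjTensorSq A :=
  ((PiTensorProduct.tprod ℂ ![b, c] : PiTensorProduct ℂ (fun _ : Fin 2 => A)) :
    UniformSpace.Completion (PiTensorProduct ℂ (fun _ : Fin 2 => A)))

/-- The left action `m ↦ a · m`, determined by `a · (b ⊗ c) = (a * b) ⊗ c`. -/
def ProjTensorSq.leftAct (a : A) : ProjTensorSq A →L[ℂ] ProjTensorSq A :=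
  ContinuousLinearMap.completion
    (PiTensorProduct.mapL (E := fun _ : Fin 2 => A) (E' := fun _ : Fin 2 => A)
      ![ContinuousLinearMap.mul ℂ A a, ContinuousLinearMap.id ℂ A])

/-- The right action `m ↦ m · a`, determined by `(b ⊗ c) · a = b ⊗ (c * a)`. -/
def ProjTensorSq.rightAct (a : A) : ProjTensorSq A →L[ℂ] ProjTensorSq A :=
  ContinuousLinearMap.completion
    (PiTensorProduct.mapL (E := fun _ : Fin 2 => A) (E' := fun _ : Fin 2 => A)
      ![ContinuousLinearMap.id ℂ A, (ContinuousLinearMap.mul ℂ A).flip a])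

/-- Multiplication `(b, c) ↦ b * c` as a continuous multilinear map of two variables. -/
def mulMultilinear : ContinuousMultilinearMap ℂ (fun _ : Fin 2 => A) A :=
  MultilinearMap.mkContinuous
    { toFun := fun v => v 0 * v 1
      map_update_add' := by
        intro _ v i x y
        fin_cases i <;> simp [add_mul, mul_add]
      map_update_smul' := by
        intro _ v i c x
        fin_cases i <;> simp [smul_mul_assoc, mul_smul_comm] }
    1 (fun v => by simpa [Fin.prod_univ_two] using norm_mul_le (v 0) (v 1))

/-- The product map `π`, determined by `π (b ⊗ c) = b * c`. -/
def ProjTensorSq.prodMap [CompleteSpace A] : ProjTensorSq A →L[ℂ] A :=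
  ContinuousLinearMap.fromCompletion
    (PiTensorProduct.liftIsometry ℂ (fun _ : Fin 2 => A) A mulMultilinear)

theorem ProjTensorSq.leftAct_tmul (a b c : A) :
    leftAct a (tmul b c) = tmul (a * b) c := by
  simp only [leftAct, tmul, ContinuousLinearMap.completion_apply_coe, PiTensorProduct.mapL_apply,
    PiTensorProduct.map_tprod]
  congr 2
  ext i
  fin_cases i <;> simp

theorem ProjTensorSq.rightAct_tmul (a b c : A) :
    rightAct a (tmul b c) = tmul b (c * a) := by
  simp only [rightAct, tmul, ContinuousLinearMap.completion_apply_coe, PiTensorProduct.mapL_apply,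
    PiTensorProduct.map_tprod]
  congr 2
  ext i
  fin_cases i <;> simp

theorem ProjTensorSq.prodMap_tmul [CompleteSpace A] (b c : A) :
    prodMap (tmul b c) = b * c := by
  simp [prodMap, tmul, mulMultilinear]

variable (A) in
/-- A Banach algebra `A` is pseudo-amenable if it has a (not necessarily bounded) approximate
diagonal: a net `(m γ)` in the projective tensor product of `A` with itself such that
`a · m γ - m γ · a → 0` and `π (m γ) * a → a` for every `a` in `A`. -/
def IsPseudoAmenable [CompleteSpace A] : Prop :=
  ∃ (Γ : Type u) (_ : Preorder Γ) (_ : Nonempty Γ) (_ : IsDirected Γ (· ≤ ·))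
    (m : Γ → ProjTensorSq A), ∀ a : A,
      Tendsto (fun γ => ProjTensorSq.leftAct a (m γ) - ProjTensorSq.rightAct a (m γ))
        atTop (𝓝 0) ∧
      Tendsto (fun γ => ProjTensorSq.prodMap (m γ) * a) atTop (𝓝 a)

end PseudoAmenable

/-! ### The group algebra, Segal algebras and amenable groups -/

section Group

variable {G : Type*} [Group G] [TopologicalSpace G] [IsTopologicalGroup G]
  [MeasurableSpace G] [BorelSpace G] (μ : Measure G) [μ.IsMulLeftInvariant]

/-- Left translation `(L_x f)(y) = f (x⁻¹ y)` on `L^p(G)`. -/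
def leftTranslate (p : ℝ≥0∞) (x : G) : Lp ℂ p μ →ₗ[ℂ] Lp ℂ p μ :=
  Lp.compMeasurePreservingₗ ℂ (fun y => x⁻¹ * y) (measurePreserving_mul_left μ x⁻¹)

/-- Convolution on `L^1(G)`: `f * g = ∫ f(y) L_y g dy`, as an integral of `L^1(G)`-valued
functions, that is `(f * g)(x) = ∫ f(y) g(y⁻¹ x) dy`. (The vector-valued form avoids
representatives; the integrand is integrable for all `f` and `g` in `L^1(G)`, because `y ↦ L_y g`
is bounded and continuous and `f` is concentrated on a `σ`-compact set.) -/
def convL1 (f g : Lp ℂ 1 μ) : Lp ℂ 1 μ :=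
  ∫ y, f y • leftTranslate μ 1 y g ∂μ

variable {μ} in
/-- `IsSegalAlgebra ι` says that the injection `ι` exhibits the Banach algebra `S` as a Segal
algebra in `L^1(G)`: `S` stands for the subspace `range ι` with its own complete norm, and its
product is convolution. -/
structure IsSegalAlgebra {S : Type*} [NonUnitalNormedRing S] [NormedSpace ℂ S]
    (ι : S →L[ℂ] Lp ℂ 1 μ) : Prop where
  injective : Function.Injective ι
  map_mul : ∀ b c : S, ι (b * c) = convL1 μ (ι b) (ι c)
  /-- `S` is dense in `L^1(G)`. -/
  dense : DenseRange ι
  /-- `S` is a left ideal. -/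
  left_ideal : ∀ (f : Lp ℂ 1 μ) (b : S), ∃ c : S, ι c = convL1 μ f (ι b)
  /-- `S` is a contractive left `L^1(G)`-module. -/
  contractive : ∀ (f : Lp ℂ 1 μ) (b c : S), ι c = convL1 μ f (ι b) → ‖c‖ ≤ ‖f‖ * ‖b‖
  /-- `S` is an essential module: `L^1(G) * S` spans a dense subspace of `S`. -/
  essential : Dense (Submodule.span ℂ
    {c : S | ∃ (f : Lp ℂ 1 μ) (b : S), ι c = convL1 μ f (ι b)} : Set S)
  /-- `S` is closed under left translations. -/
  translate : ∀ (x : G) (b : S), ∃ c : S, ι c = leftTranslate μ 1 x (ι b)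

/-- The constant function `1` in `L^∞(G)`. -/
def oneLinfty : Lp ℂ ∞ μ := (memLp_top_const (1 : ℂ)).toLp (fun _ => (1 : ℂ))

/-- `G` is amenable: there is a left invariant mean on `L^∞(G)`, that is a functional `M` with
`‖M‖ = M 1 = 1` and `M (L_x φ) = M φ`. Here `L^∞(G)` is taken modulo locally null functions, as
usual for a general locally compact group: a functional on that quotient of `Lp ℂ ∞ μ` is one on
`Lp ℂ ∞ μ` that kills the functions vanishing almost everywhere on each compact set. (For inner
regular or `σ`-finite `μ` such functions are `0` and the condition is void.) -/
def IsAmenableGroup : Prop :=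
  ∃ M : Lp ℂ ∞ μ →L[ℂ] ℂ, ‖M‖ = 1 ∧ M (oneLinfty μ) = 1 ∧
    (∀ (x : G) (φ : Lp ℂ ∞ μ), M (leftTranslate μ ∞ x φ) = M φ) ∧
    (∀ φ : Lp ℂ ∞ μ, (∀ K : Set G, IsCompact K → φ =ᵐ[μ.restrict K] 0) → M φ = 0)

end Group

end

/-! The augmentation `f ↦ ∫ f` is multiplicative on `L^1(G)` (`augmentation_convL1`), so by density
it restricts to a nonzero character `χ` of `S`. Applying `id ⊗ χ` to an approximate diagonal gives a
net `u γ` in `S` with `a * u γ - χ a • u γ → 0` and `χ (u γ) → 1`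
(`IsPseudoAmenable.exists_net_of_character`).

Fix `a` with `χ a = 1` and put `v γ = a * u γ`. The translate `b = L_x a` also has `χ b = 1`, and
`L_x (a * u γ) = b * u γ`, so `L_x (v γ) - v γ → 0` in `L^1`. Moreover `‖v γ‖ ≥ |∫ v γ| = |χ (u γ)|
→ 1`. Normalising `|v γ|` needs only this lower bound, hence the net may be unbounded; a weak-*
limit is an invariant mean (`isAmenableGroup_of_asymptotically_invariant`). -/

/-! ### The augmentation character. -/

section Augmentation

variable {G : Type*} [MeasurableSpace G] (μ : Measure G)

/-- The augmentation `f ↦ ∫ f` on `L^1(G)`. -/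
noncomputable def augmentation : Lp ℂ 1 μ →L[ℂ] ℂ := L1.integralCLM' ℂ

theorem augmentation_apply (f : Lp ℂ 1 μ) : augmentation μ f = ∫ x, f x ∂μ := by
  rw [← L1.integral_eq_integral, L1.integral_eq' ℂ]
  rfl

theorem norm_augmentation_le (f : Lp ℂ 1 μ) : ‖augmentation μ f‖ ≤ ‖f‖ := by
  rw [augmentation_apply, L1.norm_eq_integral_norm]
  exact norm_integral_le_integral_norm _

end Augmentation

/-! ### σ-compact supports of integrable functions. -/

section SigmaCompactSupport

variable {X : Type*} [TopologicalSpace X] [T2Space X] [MeasurableSpace X] [BorelSpace X]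
  {μ : Measure X} [μ.InnerRegularCompactLTTop]

/-- An integrable function is concentrated on a countable union of compact sets. -/
theorem exists_compact_seq_ae_eq_zero {E : Type*} [NormedAddCommGroup E] {f : X → E}
    (hf : Integrable f μ) :
    ∃ K : ℕ → Set X, (∀ n, IsCompact (K n)) ∧ ∀ᵐ x ∂μ, x ∉ ⋃ n, K n → f x = 0 := by
  obtain ⟨g, hg, hfg⟩ := hf.aestronglyMeasurable
  have hgi : Integrable g μ := hf.congr hfg
  -- These level sets have finite measure and cover `{g ≠ 0}`; inner regularity exhausts each by
  -- compact sets up to a null set.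
  let s : ℕ → Set X := fun n => {x | (1 : ℝ) / (n + 1) ≤ ‖g x‖}
  have hs : ∀ n, MeasurableSet (s n) := fun n => measurableSet_le measurable_const hg.norm.measurable
  have hfin : ∀ n, μ (s n) ≠ ∞ := fun n =>
    (hgi.measure_norm_ge_lt_top Nat.one_div_pos_of_nat).ne
  have hK : ∀ n m : ℕ, ∃ K ⊆ s n, IsCompact K ∧ μ (s n \ K) < ((m : ℝ≥0∞) + 1)⁻¹ := fun n m =>
    (hs n).exists_isCompact_sdiff_lt (hfin n) (by simp)
  choose K hKs hKc hKm using hK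
  refine ⟨fun k => K k.unpair.1 k.unpair.2, fun k => hKc _ _, ?_⟩
  have hnull : ∀ n, μ (s n \ ⋃ m, K n m) = 0 := by
    intro n
    refine le_antisymm (ENNReal.le_of_forall_pos_le_add fun ε hε _ => ?_) zero_le
    obtain ⟨m, hm⟩ := ENNReal.exists_inv_nat_lt (a := (ε : ℝ≥0∞)) (by simpa using hε.ne')
    calc μ (s n \ ⋃ m, K n m) ≤ μ (s n \ K n m) :=
          measure_mono (Set.sdiff_subset_sdiff_right (Set.subset_iUnion _ m))
      _ ≤ ((m : ℝ≥0∞) + 1)⁻¹ := (hKm n m).le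
      _ ≤ (m : ℝ≥0∞)⁻¹ := ENNReal.inv_le_inv.2 le_self_add
      _ ≤ 0 + ε := by simpa using hm.le
  have hae : ∀ᵐ x ∂μ, ∀ n, x ∉ s n \ ⋃ m, K n m :=
    ae_all_iff.2 fun n => measure_eq_zero_iff_ae_notMem.1 (hnull n)
  filter_upwards [hae, hfg] with x hx hfx hxK
  by_contra h0
  rw [hfx] at h0
  obtain ⟨n, hn⟩ := exists_nat_one_div_lt (norm_pos_iff.2 h0)
  refine hx n ⟨hn.le, fun hxm => hxK ?_⟩
  obtain ⟨m, hm⟩ := Set.mem_iUnion.1 hxm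
  exact Set.mem_iUnion.2 ⟨Nat.pair n m, by simpa using hm⟩

/-- On a general group `F` alone may fail to be a.e. strongly measurable; on the σ-compact set
carrying `f` its range is separable. -/
theorem MeasureTheory.Integrable.aestronglyMeasurable_smul_continuous {E : Type*}
    [NormedAddCommGroup E] [NormedSpace ℂ E] {f : X → ℂ} (hf : Integrable f μ) {F : X → E} (hF : Continuous F) :
    AEStronglyMeasurable (fun x => f x • F x) μ := by
  obtain ⟨K, hK, hae⟩ := exists_compact_seq_ae_eq_zero hf
  have hm : MeasurableSet (⋃ n, K n) := .iUnion fun n => (hK n).measurableSet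
  have h1 : AEStronglyMeasurable F (μ.restrict (⋃ n, K n)) :=
    aestronglyMeasurable_iUnion_iff.2 fun n =>
      hF.continuousOn.aestronglyMeasurable_of_isCompact (hK n) (hK n).measurableSet
  have h2 : AEStronglyMeasurable ((⋃ n, K n).indicator F) μ :=
    (aestronglyMeasurable_indicator_iff hm).2 h1
  refine (hf.aestronglyMeasurable.smul h2).congr ?_
  filter_upwards [hae] with x hx
  by_cases hxK : x ∈ ⋃ n, K n
  · simp [Set.indicator_of_mem hxK]
  · simp [hx hxK]

theorem MeasureTheory.Integrable.mul_ae_eq_zero_of_locally_null {f φ : X → ℂ} (hf : Integrable f μ)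
    (hφ : ∀ K : Set X, IsCompact K → φ =ᵐ[μ.restrict K] 0) :
    ∀ᵐ x ∂μ, f x * φ x = 0 := by
  obtain ⟨K, hK, hae⟩ := exists_compact_seq_ae_eq_zero hf
  have h : ∀ᵐ x ∂μ, ∀ n, x ∈ K n → φ x = 0 := ae_all_iff.2 fun n =>
    (ae_restrict_iff' (hK n).measurableSet).1 (hφ _ (hK n))
  filter_upwards [hae, h] with x hx hn
  by_cases hxK : x ∈ ⋃ n, K n
  · obtain ⟨n, hxn⟩ := Set.mem_iUnion.1 hxK
    simp [hn n hxn]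
  · simp [hx hxK]

end SigmaCompactSupport

/-! ### Translation and convolution on `L^1(G)`. -/

section Translation

variable {G : Type*} [Group G] [TopologicalSpace G] [IsTopologicalGroup G]
  [MeasurableSpace G] [BorelSpace G] (μ : Measure G) [μ.IsMulLeftInvariant]

theorem leftTranslate_ae_eq (p : ℝ≥0∞) (x : G) (f : Lp ℂ p μ) :
    leftTranslate μ p x f =ᵐ[μ] fun y => f (x⁻¹ * y) :=
  Lp.coeFn_compMeasurePreserving f (measurePreserving_mul_left μ x⁻¹)

/-- Left translation as an isometry of `L^1(G)`. -/
noncomputable def leftTranslateIsometry (x : G) : Lp ℂ 1 μ →ₗᵢ[ℂ] Lp ℂ 1 μ :=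
  Lp.compMeasurePreservingₗᵢ ℂ (fun y => x⁻¹ * y) (measurePreserving_mul_left μ x⁻¹)

theorem norm_leftTranslate (x : G) (f : Lp ℂ 1 μ) : ‖leftTranslate μ 1 x f‖ = ‖f‖ :=
  (leftTranslateIsometry μ x).norm_map f

theorem leftTranslate_mul (p : ℝ≥0∞) (x y : G) (f : Lp ℂ p μ) :
    leftTranslate μ p (x * y) f = leftTranslate μ p x (leftTranslate μ p y f) := by
  refine Lp.ext ?_
  have h : (fun z => leftTranslate μ p y f (x⁻¹ * z)) =ᵐ[μ] fun z => f (y⁻¹ * (x⁻¹ * z)) :=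
    (measurePreserving_mul_left μ x⁻¹).quasiMeasurePreserving.ae_eq (leftTranslate_ae_eq μ p y f)
  filter_upwards [leftTranslate_ae_eq μ p (x * y) f,
    leftTranslate_ae_eq μ p x (leftTranslate μ p y f), h] with z h1 h2 h3
  rw [h1, h2, h3, mul_inv_rev, mul_assoc]

theorem augmentation_leftTranslate (x : G) (f : Lp ℂ 1 μ) :
    augmentation μ (leftTranslate μ 1 x f) = augmentation μ f := by
  rw [augmentation_apply, augmentation_apply, integral_congr_ae (leftTranslate_ae_eq μ 1 x f)]
  exact integral_mul_left_eq_self (fun y => f y) x⁻¹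

/-- Substitute `y ↦ x * y` in the convolution integral and pull `L_x` out; as `L_x` is an isometry,
this needs no integrability. -/
theorem convL1_leftTranslate (x : G) (f g : Lp ℂ 1 μ) :
    convL1 μ (leftTranslate μ 1 x f) g = leftTranslate μ 1 x (convL1 μ f g) := by
  have h1 : convL1 μ (leftTranslate μ 1 x f) g
      = ∫ y, f (x⁻¹ * y) • leftTranslate μ 1 (x * (x⁻¹ * y)) g ∂μ := by
    refine integral_congr_ae ?_
    filter_upwards [leftTranslate_ae_eq μ 1 x f] with y hy
    rw [hy, mul_inv_cancel_left]
  rw [h1, integral_mul_left_eq_self (fun y => f y • leftTranslate μ 1 (x * y) g) x⁻¹]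
  simp_rw [leftTranslate_mul, ← map_smul (leftTranslate μ 1 x)]
  exact (leftTranslateIsometry μ x).integral_comp_comm fun y => f y • leftTranslate μ 1 y g

theorem continuous_leftTranslate [T2Space G] [IsLocallyFiniteMeasure μ]
    [μ.InnerRegularCompactLTTop] (g : Lp ℂ 1 μ) :
    Continuous fun y => leftTranslate μ 1 y g := by
  let F : C(G, C(G, G)) :=
    (ContinuousMap.mk (fun a : G × G => a.1⁻¹ * a.2) (by fun_prop)).curry
  exact (continuous_const (y := g)).compMeasurePreservingLp F.continuous
    (fun y => measurePreserving_mul_left μ y⁻¹) ENNReal.one_ne_top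

/-- Under the integral, `L_y g` has the same augmentation as `g`, which factors out. -/
theorem augmentation_convL1 [T2Space G] [IsLocallyFiniteMeasure μ]
    [μ.InnerRegularCompactLTTop] (f g : Lp ℂ 1 μ) :
    augmentation μ (convL1 μ f g) = augmentation μ f * augmentation μ g := by
  have hf : Integrable f μ := L1.integrable_coeFn f
  have hint : Integrable (fun y => f y • leftTranslate μ 1 y g) μ := by
    refine (hf.norm.mul_const ‖g‖).mono'
      (Integrable.aestronglyMeasurable_smul_continuous hf (continuous_leftTranslate μ g)) ?_
    exact .of_forall fun y => by rw [norm_smul, norm_leftTranslate]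
  rw [convL1, ← ContinuousLinearMap.integral_comp_comm _ hint]
  simp_rw [map_smul, augmentation_leftTranslate, smul_eq_mul]
  rw [integral_mul_const, ← augmentation_apply]

end Translation

/-! ### The absolute value as a contraction of `L^1`. -/

section AbsoluteValue

variable {X : Type*} [MeasurableSpace X] {μ : Measure X}

theorem lipschitzWith_complex_abs : LipschitzWith 1 fun z : ℂ => ((‖z‖ : ℝ) : ℂ) := by
  refine LipschitzWith.of_dist_le_mul fun z w => ?_
  rw [Complex.dist_eq, Complex.dist_eq, ← Complex.ofReal_sub, Complex.norm_real, Real.norm_eq_abs]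
  simpa using abs_norm_sub_norm_le z w

/-- The absolute value `|f|` of `f` in `L^1`. -/
noncomputable def absL1 (f : Lp ℂ 1 μ) : Lp ℂ 1 μ :=
  lipschitzWith_complex_abs.compLp (by simp) f

theorem absL1_ae_eq (f : Lp ℂ 1 μ) : absL1 f =ᵐ[μ] fun x => ((‖f x‖ : ℝ) : ℂ) :=
  lipschitzWith_complex_abs.coeFn_compLp (by simp) f

theorem norm_absL1_sub_le (f g : Lp ℂ 1 μ) : ‖absL1 f - absL1 g‖ ≤ ‖f - g‖ := by
  simpa [absL1] using lipschitzWith_complex_abs.norm_compLp_sub_le (by simp) f g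

theorem norm_absL1 (f : Lp ℂ 1 μ) : ‖absL1 f‖ = ‖f‖ := by
  rw [L1.norm_eq_integral_norm, L1.norm_eq_integral_norm]
  refine integral_congr_ae ?_
  filter_upwards [absL1_ae_eq f] with x hx
  simp [hx]

theorem integral_absL1 (f : Lp ℂ 1 μ) : ∫ x, absL1 f x ∂μ = (‖f‖ : ℂ) := by
  rw [L1.norm_eq_integral_norm, ← integral_complex_ofReal]
  exact integral_congr_ae (absL1_ae_eq f)

end AbsoluteValue

/-! ### Means on `L^∞` coming from `L^1`. -/

section Pairing

variable {G : Type*} [MeasurableSpace G] {μ : Measure G}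

/-- The pairing `(w, φ) ↦ ∫ w φ` of `L^1(G)` and `L^∞(G)`. -/
noncomputable def l1Pairing (μ : Measure G) : Lp ℂ 1 μ →L[ℂ] Lp ℂ ∞ μ →L[ℂ] ℂ :=
  (ContinuousLinearMap.mul ℂ ℂ).lpPairing μ 1 ∞

theorem l1Pairing_apply (w : Lp ℂ 1 μ) (φ : Lp ℂ ∞ μ) :
    l1Pairing μ w φ = ∫ x, w x * φ x ∂μ :=
  ContinuousLinearMap.lpPairing_eq_integral _ w φ

theorem norm_l1Pairing_apply_le (w : Lp ℂ 1 μ) (φ : Lp ℂ ∞ μ) :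
    ‖l1Pairing μ w φ‖ ≤ ‖w‖ * ‖φ‖ := by
  rw [l1Pairing_apply, L1.norm_eq_integral_norm, ← integral_mul_const]
  refine norm_integral_le_of_norm_le ((L1.integrable_coeFn w).norm.mul_const _) ?_
  have hφ : eLpNormEssSup φ μ ≠ ∞ := by
    simpa [eLpNorm_exponent_top] using Lp.eLpNorm_ne_top φ
  filter_upwards [ae_le_eLpNormEssSup (f := φ) (μ := μ)] with x hx
  rw [norm_mul]
  refine mul_le_mul_of_nonneg_left ?_ (norm_nonneg _)
  rw [Lp.norm_def, eLpNorm_exponent_top, ← toReal_enorm]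
  exact ENNReal.toReal_mono hφ hx

theorem norm_l1Pairing_le (w : Lp ℂ 1 μ) : ‖l1Pairing μ w‖ ≤ ‖w‖ :=
  ContinuousLinearMap.opNorm_le_bound _ (norm_nonneg _) (norm_l1Pairing_apply_le w)

theorem oneLinfty_ae_eq (μ : Measure G) :
    oneLinfty μ =ᵐ[μ] fun _ => (1 : ℂ) :=
  (memLp_top_const (1 : ℂ)).coeFn_toLp

theorem l1Pairing_oneLinfty (w : Lp ℂ 1 μ) :
    l1Pairing μ w (oneLinfty μ) = ∫ x, w x ∂μ := by
  rw [l1Pairing_apply]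
  refine integral_congr_ae ?_
  filter_upwards [oneLinfty_ae_eq μ] with x hx
  rw [hx, mul_one]

theorem norm_oneLinfty_le (μ : Measure G) : ‖oneLinfty μ‖ ≤ 1 := by
  rw [Lp.norm_def, eLpNorm_congr_ae (oneLinfty_ae_eq μ), eLpNorm_exponent_top]
  refine ENNReal.toReal_le_of_le_ofReal zero_le_one ?_
  exact eLpNormEssSup_le_of_ae_bound (.of_forall fun _ => norm_one.le)

/-- The functional `φ ↦ ‖v‖⁻¹ * ∫ |v| φ`. -/
noncomputable def normalizedMean (v : Lp ℂ 1 μ) : Lp ℂ ∞ μ →L[ℂ] ℂ :=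
  ((‖v‖⁻¹ : ℝ) : ℂ) • l1Pairing μ (absL1 v)

theorem norm_normalizedMean_le (v : Lp ℂ 1 μ) : ‖normalizedMean v‖ ≤ 1 := by
  rw [normalizedMean, norm_smul, Complex.norm_real, norm_inv, norm_norm]
  calc ‖v‖⁻¹ * ‖l1Pairing μ (absL1 v)‖ ≤ ‖v‖⁻¹ * ‖v‖ := by
        gcongr
        exact (norm_l1Pairing_le _).trans_eq (norm_absL1 v)
    _ ≤ 1 := inv_mul_le_one

theorem l1Pairing_eq_zero_of_locally_null [TopologicalSpace G] [T2Space G] [BorelSpace G]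
    [μ.InnerRegularCompactLTTop] (w : Lp ℂ 1 μ) (φ : Lp ℂ ∞ μ)
    (hφ : ∀ K : Set G, IsCompact K → φ =ᵐ[μ.restrict K] 0) : l1Pairing μ w φ = 0 := by
  rw [l1Pairing_apply]
  exact integral_eq_zero_of_ae
    (Integrable.mul_ae_eq_zero_of_locally_null (L1.integrable_coeFn w) hφ)

theorem normalizedMean_oneLinfty {v : Lp ℂ 1 μ} (hv : v ≠ 0) :
    normalizedMean v (oneLinfty μ) = 1 := by
  have h : (‖v‖ : ℂ) ≠ 0 := by simpa using hv
  rw [normalizedMean, smul_apply, l1Pairing_oneLinfty, integral_absL1,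
    smul_eq_mul, Complex.ofReal_inv, inv_mul_cancel₀ h]

end Pairing

/-! ### From asymptotic invariance to an invariant mean. -/

section ReiterCondition

variable {G : Type*} [Group G] [TopologicalSpace G] [IsTopologicalGroup G]
  [MeasurableSpace G] [BorelSpace G] {μ : Measure G} [μ.IsMulLeftInvariant]

theorem leftTranslate_absL1 (x : G) (f : Lp ℂ 1 μ) :
    leftTranslate μ 1 x (absL1 f) = absL1 (leftTranslate μ 1 x f) := by
  refine Lp.ext ?_
  have h := (measurePreserving_mul_left μ x⁻¹).quasiMeasurePreserving.ae_eq (absL1_ae_eq f)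
  filter_upwards [leftTranslate_ae_eq μ 1 x (absL1 f), absL1_ae_eq (leftTranslate μ 1 x f),
    leftTranslate_ae_eq μ 1 x f, h] with y h1 h2 h3 h4
  rw [h1, h2, h3]
  exact h4

theorem l1Pairing_leftTranslate (x : G) (w : Lp ℂ 1 μ) (φ : Lp ℂ ∞ μ) :
    l1Pairing μ w (leftTranslate μ ∞ x φ) = l1Pairing μ (leftTranslate μ 1 x⁻¹ w) φ := by
  rw [l1Pairing_apply, l1Pairing_apply,
    ← integral_mul_left_eq_self (fun y => leftTranslate μ 1 x⁻¹ w y * φ y) x⁻¹]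
  refine integral_congr_ae ?_
  have h := (measurePreserving_mul_left μ x⁻¹).quasiMeasurePreserving.ae_eq
    (leftTranslate_ae_eq μ 1 x⁻¹ w)
  filter_upwards [leftTranslate_ae_eq μ ∞ x φ, h] with y h1 h2
  simp only [Function.comp_apply] at h2
  rw [h1, h2]
  simp

/-- Move the translation onto `|v|`; it commutes with the absolute value, which is a contraction. -/
theorem norm_normalizedMean_leftTranslate_sub_le (v : Lp ℂ 1 μ) (x : G) (φ : Lp ℂ ∞ μ) :
    ‖normalizedMean v (leftTranslate μ ∞ x φ) - normalizedMean v φ‖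
      ≤ ‖v‖⁻¹ * (‖leftTranslate μ 1 x⁻¹ v - v‖ * ‖φ‖) := by
  simp only [normalizedMean, smul_apply]
  rw [l1Pairing_leftTranslate, leftTranslate_absL1, ← smul_sub, ← sub_apply,
    ← map_sub, norm_smul, Complex.norm_real, norm_inv, norm_norm]
  gcongr
  exact (norm_l1Pairing_apply_le _ _).trans (by gcongr; exact norm_absL1_sub_le _ _)

/-- A net in `L^1(G)` that is asymptotically invariant and has norm bounded below yields a left
invariant mean. -/
theorem isAmenableGroup_of_asymptotically_invariant [T2Space G] [μ.InnerRegularCompactLTTop]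
    {Γ : Type*} {l : Filter Γ} [l.NeBot] {v : Γ → Lp ℂ 1 μ} {c : ℝ} (hc : 0 < c)
    (hv : ∀ᶠ γ in l, c ≤ ‖v γ‖)
    (hinv : ∀ x : G, Tendsto (fun γ => leftTranslate μ 1 x (v γ) - v γ) l (𝓝 0)) :
    IsAmenableGroup μ := by
  -- Along an ultrafilter, Banach–Alaoglu gives a weak-* limit of the whole family, with no passage
  -- to subnets.
  let U : Ultrafilter Γ := Ultrafilter.of l
  have hU : (U : Filter Γ) ≤ l := Ultrafilter.of_le l
  let N : Γ → WeakDual ℂ (Lp ℂ ∞ μ) := fun γ => StrongDual.toWeakDual (normalizedMean (v γ))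
  obtain ⟨M, hM, hlim⟩ := (WeakDual.isCompact_closedBall (0 : StrongDual ℂ (Lp ℂ ∞ μ)) 1)
    |>.ultrafilter_le_nhds (U.map N) (by
      refine le_principal_iff.2 (mem_map.2 (univ_mem' fun γ => ?_))
      exact mem_closedBall_zero_iff.2 (norm_normalizedMean_le (v γ)))
  have heval : ∀ φ : Lp ℂ ∞ μ, Tendsto (fun γ => normalizedMean (v γ) φ) U (𝓝 (M φ)) := fun φ =>
    ((WeakDual.eval_continuous φ).tendsto M).comp hlim
  have hM1 : ‖WeakDual.toStrongDual M‖ ≤ 1 := mem_closedBall_zero_iff.1 hM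
  have hone : M (oneLinfty μ) = 1 := by
    refine tendsto_nhds_unique (heval _) (tendsto_const_nhds.congr' ?_)
    filter_upwards [hU hv] with γ hγ
    exact (normalizedMean_oneLinfty (norm_pos_iff.1 (hc.trans_le hγ))).symm
  refine ⟨WeakDual.toStrongDual M, le_antisymm hM1 ?_, hone, fun x φ => ?_, fun φ hφ => ?_⟩
  · have h := (WeakDual.toStrongDual M).le_opNorm (oneLinfty μ)
    calc (1 : ℝ) = ‖M (oneLinfty μ)‖ := by rw [hone, norm_one]
      _ ≤ ‖WeakDual.toStrongDual M‖ * ‖oneLinfty μ‖ := h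
      _ ≤ ‖WeakDual.toStrongDual M‖ * 1 := by gcongr; exact norm_oneLinfty_le μ
      _ = _ := mul_one _
  · refine sub_eq_zero.1 (tendsto_nhds_unique ((heval _).sub (heval φ)) ?_)
    -- The lower bound `c` replaces the varying factor `‖v γ‖⁻¹` by a constant.
    have h0 : Tendsto (fun γ => c⁻¹ * (‖leftTranslate μ 1 x⁻¹ (v γ) - v γ‖ * ‖φ‖)) U (𝓝 0) := by
      simpa using (((hinv x⁻¹).mono_left hU).norm.mul_const ‖φ‖).const_mul c⁻¹
    refine squeeze_zero_norm' ?_ h0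
    filter_upwards [hU hv] with γ hγ
    refine (norm_normalizedMean_leftTranslate_sub_le _ _ _).trans ?_
    gcongr
  · refine tendsto_nhds_unique (heval φ) (tendsto_const_nhds.congr fun γ => ?_)
    rw [normalizedMean, smul_apply, l1Pairing_eq_zero_of_locally_null _ _ hφ,
      smul_zero]

end ReiterCondition

/-! ### Slicing the approximate diagonal by a character. -/

section CharacterMap

universe u

variable {A : Type u} [NonUnitalNormedRing A] [NormedSpace ℂ A]

/-- The bilinear map `(b, c) ↦ χ c • b`. -/
noncomputable def sliceMultilinear (χ : A →L[ℂ] ℂ) :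
    ContinuousMultilinearMap ℂ (fun _ : Fin 2 => A) A :=
  MultilinearMap.mkContinuous
    { toFun := fun v => χ (v 1) • v 0
      map_update_add' := by
        intro _ v i x y
        fin_cases i <;> simp [add_smul]
      map_update_smul' := by
        intro _ v i c x
        fin_cases i <;> simp [mul_smul, smul_comm c] }
    ‖χ‖ (fun v => by
      simp only [MultilinearMap.coe_mk, norm_smul, Fin.prod_univ_two]
      calc ‖χ (v 1)‖ * ‖v 0‖ ≤ ‖χ‖ * ‖v 1‖ * ‖v 0‖ := by gcongr; exact χ.le_opNorm _
        _ = _ := by ring)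

/-- The slice map determined by `b ⊗ c ↦ χ c • b`. -/
noncomputable def ProjTensorSq.slice [CompleteSpace A] (χ : A →L[ℂ] ℂ) :
    ProjTensorSq A →L[ℂ] A :=
  ContinuousLinearMap.fromCompletion
    (PiTensorProduct.liftIsometry ℂ (fun _ : Fin 2 => A) A (sliceMultilinear χ))

theorem ProjTensorSq.slice_tmul [CompleteSpace A] (χ : A →L[ℂ] ℂ) (b c : A) :
    slice χ (tmul b c) = χ c • b := by
  simp [slice, tmul, sliceMultilinear]

theorem ProjTensorSq.ext_tmul {E : Type*} [NormedAddCommGroup E] [NormedSpace ℂ E]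
    {S T : ProjTensorSq A →L[ℂ] E} (h : ∀ b c : A, S (tmul b c) = T (tmul b c)) : S = T := by
  ext m
  induction m using UniformSpace.Completion.induction_on with
  | hp => exact isClosed_eq S.continuous T.continuous
  | ih m =>
    induction m using PiTensorProduct.induction_on with
    | smul_tprod r f =>
      have hf : f = ![f 0, f 1] := by ext i; fin_cases i <;> rfl
      rw [UniformSpace.Completion.coe_smul, map_smul, map_smul, hf]
      exact congrArg (r • ·) (h (f 0) (f 1))
    | add x y hx hy => rw [UniformSpace.Completion.coe_add, map_add, map_add, hx, hy]

variable [IsScalarTower ℂ A A] [SMulCommClass ℂ A A] [CompleteSpace A]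

theorem ProjTensorSq.slice_leftAct (χ : A →L[ℂ] ℂ) (a : A) (m : ProjTensorSq A) :
    slice χ (leftAct a m) = a * slice χ m := by
  have h : (slice χ).comp (leftAct a) = (ContinuousLinearMap.mul ℂ A a).comp (slice χ) :=
    ext_tmul fun b c => by
      simp [leftAct_tmul, slice_tmul]
  exact congrArg (fun T => T m) h

/-- The right action touches only the factor that `χ` evaluates, so multiplicativity turns it into a
scalar. -/
theorem ProjTensorSq.slice_rightAct {χ : A →L[ℂ] ℂ} (hχ : ∀ b c, χ (b * c) = χ b * χ c) (a : A)
    (m : ProjTensorSq A) : slice χ (rightAct a m) = χ a • slice χ m := by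
  have h : (slice χ).comp (rightAct a) = χ a • slice χ :=
    ext_tmul fun b c => by
      simp [rightAct_tmul, slice_tmul, hχ, mul_smul, smul_comm (χ c)]
  exact congrArg (fun T => T m) h

theorem ProjTensorSq.apply_slice {χ : A →L[ℂ] ℂ} (hχ : ∀ b c, χ (b * c) = χ b * χ c)
    (m : ProjTensorSq A) : χ (slice χ m) = χ (prodMap m) := by
  have h : χ.comp (slice χ) = χ.comp prodMap :=
    ext_tmul fun b c => by
      simp [prodMap_tmul, slice_tmul, hχ, mul_comm]
  exact congrArg (fun T => T m) h

/-- A pseudo-amenable Banach algebra is (not necessarily boundedly) left `χ`-amenable for each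
character `χ`. -/
theorem IsPseudoAmenable.exists_net_of_character (h : IsPseudoAmenable A) {χ : A →L[ℂ] ℂ}
    (hχ : ∀ b c, χ (b * c) = χ b * χ c) {a₀ : A} (ha₀ : χ a₀ ≠ 0) :
    ∃ (Γ : Type u) (l : Filter Γ) (_ : l.NeBot) (u : Γ → A),
      (∀ a, Tendsto (fun γ => a * u γ - χ a • u γ) l (𝓝 0)) ∧
        Tendsto (fun γ => χ (u γ)) l (𝓝 1) := by
  obtain ⟨Γ, _, _, _, m, hm⟩ := h
  refine ⟨Γ, atTop, inferInstance, fun γ => ProjTensorSq.slice χ (m γ), fun a => ?_, ?_⟩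
  · have := ((ProjTensorSq.slice χ).continuous.tendsto 0).comp (hm a).1
    simpa [Function.comp_def, ProjTensorSq.slice_leftAct, ProjTensorSq.slice_rightAct hχ] using this
  -- Apply `χ` to `π (m γ) * a₀ → a₀` and divide by `χ a₀`.
  · have := ((χ.continuous.tendsto a₀).comp (hm a₀).2).mul_const (χ a₀)⁻¹
    simpa [Function.comp_def, hχ, ha₀, ProjTensorSq.apply_slice hχ] using this

end CharacterMap

/-! ### The theorem for Segal algebras. -/

theorem exists_augmentation_ne_zero {G : Type*} [Group G] [TopologicalSpace G]
    [IsTopologicalGroup G] [LocallyCompactSpace G] [T2Space G] [MeasurableSpace G] [BorelSpace G]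
    (μ : Measure G) [μ.IsHaarMeasure] : ∃ f : Lp ℂ 1 μ, augmentation μ f ≠ 0 := by
  obtain ⟨K, hK, hK1⟩ := exists_compact_mem_nhds (1 : G)
  refine ⟨indicatorConstLp 1 hK.measurableSet hK.measure_lt_top.ne 1, ?_⟩
  rw [augmentation_apply, integral_indicatorConstLp]
  have h0 : μ K ≠ 0 := (Measure.measure_pos_of_mem_nhds μ hK1).ne'
  simp [Measure.real, ENNReal.toReal_eq_zero_iff, h0, hK.measure_lt_top.ne]

theorem mainTheorem2 {G : Type*} [Group G] [TopologicalSpace G] [IsTopologicalGroup G]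
    [T2Space G] [LocallyCompactSpace G] [MeasurableSpace G] [BorelSpace G]
    (μ : Measure G) [μ.IsHaarMeasure] [μ.InnerRegularCompactLTTop]
    {S : Type*} [NonUnitalNormedRing S] [NormedSpace ℂ S] [IsScalarTower ℂ S S]
    [SMulCommClass ℂ S S] [CompleteSpace S]
    (ι : S →L[ℂ] Lp ℂ 1 μ) (hS : IsSegalAlgebra ι) (h : IsPseudoAmenable S) :
    IsAmenableGroup μ := by
  let χ : S →L[ℂ] ℂ := (augmentation μ).comp ι
  have hχ : ∀ b c, χ (b * c) = χ b * χ c := fun b c => by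
    simp only [χ, ContinuousLinearMap.comp_apply, hS.map_mul, augmentation_convL1]
  obtain ⟨a₀, ha₀⟩ : ∃ a, χ a ≠ 0 := by
    by_contra! h0
    obtain ⟨f, hf⟩ := exists_augmentation_ne_zero μ
    refine hf (congrFun (hS.dense.equalizer (augmentation μ).continuous continuous_const ?_) f)
    exact funext h0
  obtain ⟨a, ha⟩ : ∃ a, χ a = 1 := ⟨(χ a₀)⁻¹ • a₀, by simp [ha₀]⟩
  obtain ⟨Γ, l, _, u, hu, hu1⟩ := h.exists_net_of_character hχ ha₀
  have key : ∀ b, χ b = 1 → Tendsto (fun γ => ι (b * u γ) - ι (u γ)) l (𝓝 0) := fun b hb => by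
    simpa [Function.comp_def, hb] using (ι.continuous.tendsto 0).comp (hu b)
  -- The factor `a` is essential: a translate of `a * u γ` is again a multiple of `u γ`, whereas
  -- `L_x` of `u γ` itself is not controlled.
  refine isAmenableGroup_of_asymptotically_invariant (l := l) (v := fun γ => ι (a * u γ))
    (c := 1 / 2) (by norm_num) ?_ fun x => ?_
  · have hn : ∀ᶠ γ in l, 1 / 2 < ‖χ (u γ)‖ :=
      hu1.norm.eventually_const_lt (by norm_num)
    filter_upwards [hn] with γ hγ
    calc (1 / 2 : ℝ) ≤ ‖χ (u γ)‖ := hγ.le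
      _ = ‖augmentation μ (ι (a * u γ))‖ := by
        rw [show augmentation μ (ι (a * u γ)) = χ (a * u γ) from rfl, hχ, ha, one_mul]
      _ ≤ _ := norm_augmentation_le μ _
  · obtain ⟨b, hb⟩ := hS.translate x a
    have hb1 : χ b = 1 := by
      simp only [χ, ContinuousLinearMap.comp_apply, hb, augmentation_leftTranslate]
      exact ha
    have hconv : ∀ γ, leftTranslate μ 1 x (ι (a * u γ)) = ι (b * u γ) := fun γ => by
      rw [hS.map_mul, hS.map_mul, hb, convL1_leftTranslate]
    -- Both `b * u γ` and `a * u γ` are asymptotic to `u γ`, which cancels.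
    simpa [hconv] using (key b hb1).sub (key a ha)
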